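/- Let $(\Omega,\mathcal F,\mathbb P)$ be an atomless probability space, $\mathcal X=L^\infty(\Omega,\mathcal F,\mathbb P)$, $N\ge 1$, and let $\mathcal Y$ be a law-invariant set of $\mathbb R^N$-valued random vectors (if $\mathbf W\in\mathcal Y$ and $\mathbf W'\overset{d}{=}\mathbf W$, then $\mathbf W'\in\mathcal Y$). Let $\rho:\mathcal X\times\mathcal Y\to\mathbb R$. Consider the axioms: - (M) $X\le X'$ a.s. implies $\rho(X,\mathbf W)\le\rho(X',\mathbf W)$ for all $\mathbf W\in\mathcal Y$; - (OR) $\rho(\phi(X),\mathbf W)=\phi(\rho(X,\mathbf W))$ for all $X\in\mathcal X$, $\mathbf W\in\mathcal Y$ and all continuous strictly increasing $\phi:\mathbb R\to\mathbb R$; - (LI) $(X,\mathbf W)\overset{d}{=}(X',\mathbf W')$ implies $\rho(X,\mathbf W)=\rho(X',\mathbf W')$. Let $D^*$ be the set of Borel functions $f:\mathbb R^N\to[0,1]$. A set $D$ of $[0,1]$-valued functions (a subset of $D^*$, respectively of all functions $S\to[0,1]$ on a given set $S$) is called increasing if $1\in D$, $0\notin D$, and $g\in D$ whenever $g$ belongs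 to $D^*$ (respectively is a function $S\to[0,1]$) and $g\ge f$ pointwise for some $f\in D$. For a probability measure $\mu$ on $\mathbb R^N$, $f\in_\mu D$ means that $f=g$ $\mu$-a.e. for some $g\in D$. Write $F_{X|\mathbf W=\cdot}(x)=\mathbb P(X\le x\mid\mathbf W=\cdot)\in D^*$. For a real random variable $Z$ with distribution function $F_Z$ let $\mathrm{VaR}_\alpha(Z)=\inf\{x\in\mathbb R:F_Z(x)\ge\alpha\}$, $\alpha\in(0,1]$, with $\inf\emptyset=\infty$, and for a random vector let $\mathrm{VaR}_{\boldsymbol\alpha}(\mathbf W)=(\mathrm{VaR}_{\alpha_1}(W_1),\dots,\mathrm{VaR}_{\alpha_N}(W_N))$. Let $S_{\mathbf W}$ be the set of all $(\boldsymbol\alpha,\boldsymbol\beta)\in(0,1)^N\times(0,1]^N$ with $\mathbb P(\mathrm{VaR}_{\boldsymbol\alpha}(\mathbf W)\le\mathbf W\le\mathrm{VaR}_{\boldsymbol\beta}(\mathbf W))>0$ (inequalities componentwise); it depends only on the law of $\mathbf W$. A family of sets indexed by $\mathbf W\in\mathcal Y$ is called law-invariant if the sets for $\mathbf W$ and $\mathbf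 W'$ coincide whenever $\mathbf W\overset{d}{=}\mathbf W'$. Then $\rho$ satisfies (M), (OR) and (LI) if and only if (i) holds, and also if and only if (ii) holds, where: (i) there is a law-invariant family of increasing sets $D_{\mathbf W}\subset D^*$, $\mathbf W\in\mathcal Y$, such that for all $X\in\mathcal X$, $\mathbf W\in\mathcal Y$, $$\rho(X,\mathbf W)=\inf\{x\in\mathbb R:F_{X|\mathbf W=\cdot}(x)\in_{\mathbb P\circ\mathbf W^{-1}}D_{\mathbf W}\};$$ (ii) there is a law-invariant family of increasing sets $\widehat D_{\mathbf W}$ of functions $S_{\mathbf W}\to[0,1]$, $\mathbf W\in\mathcal Y$, such that for all $X\in\mathcal X$, $\mathbf W\in\mathcal Y$, $$\rho(X,\mathbf W)=\inf\Big\{x\in\mathbb R:\big(\mathbb P(X\le x\mid\mathrm{VaR}_{\boldsymbol\alpha}(\mathbf W)\le\mathbf W\le\mathrm{VaR}_{\boldsymbol\beta}(\mathbf W))\big)_{(\boldsymbol\alpha,\boldsymbol\beta)\in S_{\mathbf W}}\in\widehat D_{\mathbf W}\Big\}.$$ -/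

import Mathlib

open MeasureTheory ProbabilityTheory

namespace FactorRisk

noncomputable section

/-- A measure is atomless if every measurable set of positive measure has a measurable subset of
strictly smaller positive measure. (`MeasureTheory.NoAtoms` only says that singletons are null.) -/
def IsAtomless {Ω : Type*} [MeasurableSpace Ω] (P : Measure Ω) : Prop :=
  ∀ A : Set Ω, MeasurableSet A → 0 < P A →
    ∃ B : Set Ω, MeasurableSet B ∧ B ⊆ A ∧ 0 < P B ∧ P B < P A

/-- The loss variables: `L^∞`, the essentially bounded random variables. Equality almost surely is
not built in: every law-invariant functional respects it. -/
def LInfty {Ω : Type*} [MeasurableSpace Ω] (P : Measure Ω) : Type _ :=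
  {X : Ω → ℝ // Measurable X ∧ MemLp X ⊤ P}

/-- Random vectors with values in `ℝ^N`. -/
def RandomVector (Ω : Type*) [MeasurableSpace Ω] (N : ℕ) : Type _ :=
  {W : Ω → (Fin N → ℝ) // Measurable W}

/-- The random variable `φ(X)`, for `φ` continuous and `X` in `L^∞`. -/
def LInfty.comp {Ω : Type*} [MeasurableSpace Ω] {P : Measure Ω}
    (φ : ℝ → ℝ) (hφ : Continuous φ) (X : LInfty P) : LInfty P :=
  ⟨fun ω => φ (X.1 ω), hφ.measurable.comp X.2.1, by
    obtain ⟨C, hC⟩ := (isCompact_Icc (a := -(eLpNormEssSup X.1 P).toReal)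
      (b := (eLpNormEssSup X.1 P).toReal)).exists_bound_of_continuousOn hφ.continuousOn
    refine memLp_top_of_bound (hφ.measurable.comp X.2.1).aestronglyMeasurable C ?_
    have hfin : eLpNormEssSup X.1 P ≠ ⊤ := by
      have h := X.2.2.2
      rw [eLpNorm_exponent_top] at h
      exact h.ne
    filter_upwards [enorm_ae_le_eLpNormEssSup X.1 P] with ω hω
    apply hC
    have h := ENNReal.toReal_mono hfin hω
    rw [toReal_enorm, Real.norm_eq_abs] at h
    exact abs_le.1 h⟩

/-- A set of random vectors is law-invariant if it contains, with a random vector, every random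
vector on the same space that has the same distribution. -/
def IsLawInvariantSet {Ω : Type*} [MeasurableSpace Ω] (P : Measure Ω) {N : ℕ}
    (Y : Set (RandomVector Ω N)) : Prop :=
  ∀ W ∈ Y, ∀ W' : RandomVector Ω N, IdentDistrib W'.1 W.1 P P → W' ∈ Y

section Axioms

variable {Ω : Type*} [MeasurableSpace Ω] {P : Measure Ω} {N : ℕ} {Y : Set (RandomVector Ω N)}

/-- Axiom (M). The order on `L^∞` is the almost sure one. -/
def Monotonicity (ρ : LInfty P → Y → ℝ) : Prop :=
  ∀ (X X' : LInfty P) (W : Y), X.1 ≤ᵐ[P] X'.1 → ρ X W ≤ ρ X' W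

/-- Axiom (OR). -/
def Ordinality (ρ : LInfty P → Y → ℝ) : Prop :=
  ∀ (φ : ℝ → ℝ) (hφ : Continuous φ), StrictMono φ →
    ∀ (X : LInfty P) (W : Y), ρ (X.comp φ hφ) W = φ (ρ X W)

/-- Axiom (LI): equality of the joint laws of the risk and the factor. -/
def LawInvariance (ρ : LInfty P → Y → ℝ) : Prop :=
  ∀ (X X' : LInfty P) (W W' : Y),
    IdentDistrib (fun ω => (X.1 ω, W.1.1 ω)) (fun ω => (X'.1 ω, W'.1.1 ω)) P P →
      ρ X W = ρ X' W'

end Axioms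

/-! Sets of Borel functions of the factor. -/

/-- `D` is an increasing subset of the set `D*` of Borel functions `ℝ^N → [0,1]`. -/
structure IsIncreasingBorel {N : ℕ} (D : Set ((Fin N → ℝ) → unitInterval)) : Prop where
  measurable : ∀ f ∈ D, Measurable f
  one_mem : (fun _ => 1) ∈ D
  zero_notMem : (fun _ => 0) ∉ D
  upper : ∀ f ∈ D, ∀ g : (Fin N → ℝ) → unitInterval, Measurable g → f ≤ g → g ∈ D

/-- `f ∈_μ D`: `f` agrees `μ`-almost everywhere with an element of `D`. -/
def MemAE {N : ℕ} (μ : Measure (Fin N → ℝ)) (f : (Fin N → ℝ) → unitInterval)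
    (D : Set ((Fin N → ℝ) → unitInterval)) : Prop :=
  ∃ g ∈ D, f =ᵐ[μ] g

/-- `F_{X|W=·}(x)`, the function `w ↦ P(X ≤ x | W = w)` (the version given by the regular
conditional distribution of `X` given `W`). -/
def condCDFGiven {Ω : Type*} [MeasurableSpace Ω] (P : Measure Ω) [IsProbabilityMeasure P] {N : ℕ}
    (X : Ω → ℝ) (W : Ω → (Fin N → ℝ)) (x : ℝ) (w : Fin N → ℝ) : unitInterval :=
  ⟨(condDistrib X W P w).real (Set.Iic x), measureReal_nonneg, measureReal_le_one⟩

/-! Conditioning on quantile boxes. -/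

/-- `VaR_α(Z) = inf {x ∈ ℝ : F_Z(x) ≥ α}`, with `inf ∅ = ∞`. -/
def VaR {Ω : Type*} [MeasurableSpace Ω] (P : Measure Ω) (Z : Ω → ℝ) (α : ℝ) : EReal :=
  sInf ((fun x : ℝ => (x : EReal)) '' {x : ℝ | α ≤ cdf (P.map Z) x})

/-- The event `VaR_α(W) ≤ W ≤ VaR_β(W)`, with componentwise inequalities and quantiles. -/
def quantileBox {Ω : Type*} [MeasurableSpace Ω] (P : Measure Ω) {N : ℕ}
    (W : Ω → (Fin N → ℝ)) (α β : Fin N → ℝ) : Set Ω :=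
  {ω | ∀ i, VaR P (fun ω' => W ω' i) (α i) ≤ (W ω i : EReal) ∧
    (W ω i : EReal) ≤ VaR P (fun ω' => W ω' i) (β i)}

/-- The index set `S_W` of the pairs `(α, β)` whose quantile box has positive probability. -/
def boxIndex {Ω : Type*} [MeasurableSpace Ω] (P : Measure Ω) {N : ℕ}
    (W : Ω → (Fin N → ℝ)) : Set ((Fin N → ℝ) × (Fin N → ℝ)) :=
  {p | (∀ i, p.1 i ∈ Set.Ioo (0 : ℝ) 1) ∧ (∀ i, p.2 i ∈ Set.Ioc (0 : ℝ) 1) ∧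
    0 < P (quantileBox P W p.1 p.2)}

/-- `S_W` depends on the law of `W` only. -/
theorem boxIndex_eq_of_identDistrib {Ω : Type*} [MeasurableSpace Ω] {P : Measure Ω} {N : ℕ}
    {W W' : Ω → (Fin N → ℝ)} (h : IdentDistrib W W' P P) : boxIndex P W = boxIndex P W' := by
  have hV : ∀ i α, VaR P (fun ω' => W ω' i) α = VaR P (fun ω' => W' ω' i) α := by
    intro i α
    have h' : P.map (fun ω' => W ω' i) = P.map (fun ω' => W' ω' i) :=
      (h.comp (measurable_pi_apply i)).map_eq
    simp only [VaR, h']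
  have hB : ∀ α β, P (quantileBox P W α β) = P (quantileBox P W' α β) := by
    intro α β
    have hs : MeasurableSet {w : Fin N → ℝ | ∀ i,
        VaR P (fun ω' => W' ω' i) (α i) ≤ (w i : EReal) ∧
          (w i : EReal) ≤ VaR P (fun ω' => W' ω' i) (β i)} := by
      rw [Set.setOf_forall]
      refine MeasurableSet.iInter fun i => ?_
      have hm : Measurable fun w : Fin N → ℝ => ((w i : ℝ) : EReal) :=
        measurable_coe_real_ereal.comp (measurable_pi_apply i)
      exact (measurableSet_le measurable_const hm).inter (measurableSet_le hm measurable_const)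
    have h1 := h.measure_mem_eq hs
    simp only [quantileBox, hV]
    exact h1
  ext p
  simp only [boxIndex, Set.mem_setOf_eq, hB]

/-- `(F_{X | VaR_α(W) ≤ W ≤ VaR_β(W)}(x))`, as a function of `(α, β) ∈ S_W`. -/
def boxCDF {Ω : Type*} [MeasurableSpace Ω] (P : Measure Ω) [IsProbabilityMeasure P] {N : ℕ}
    (X : Ω → ℝ) (W : Ω → (Fin N → ℝ)) (x : ℝ) (p : boxIndex P W) : unitInterval :=
  ⟨(cond P (quantileBox P W p.1.1 p.1.2)).real {ω | X ω ≤ x},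
    measureReal_nonneg, measureReal_le_one⟩

/-- An increasing set of functions `S → [0,1]`. -/
structure IsIncreasing {S : Type*} (D : Set (S → unitInterval)) : Prop where
  one_mem : (fun _ => 1) ∈ D
  zero_notMem : (fun _ => 0) ∉ D
  upper : ∀ f ∈ D, ∀ g : S → unitInterval, f ≤ g → g ∈ D

/-! The two representations. The infima over `x ∈ ℝ` are stated through `IsGLB` in `ℝ`: the set is
nonempty and bounded below, and `ρ(X, W)` is its greatest lower bound. -/

/-- There is a law-invariant family of increasing sets `D_W` of Borel functions with
`ρ(X, W) = inf {x : F_{X|W=·}(x) ∈_{P∘W⁻¹} D_W}`. -/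
def HasConditionalForm {Ω : Type*} [MeasurableSpace Ω] {P : Measure Ω} [IsProbabilityMeasure P]
    {N : ℕ} {Y : Set (RandomVector Ω N)} (ρ : LInfty P → Y → ℝ) : Prop :=
  ∃ D : Y → Set ((Fin N → ℝ) → unitInterval),
    (∀ W, IsIncreasingBorel (D W)) ∧
    (∀ W W' : Y, IdentDistrib W.1.1 W'.1.1 P P → D W = D W') ∧
    ∀ (X : LInfty P) (W : Y),
      IsGLB {x : ℝ | MemAE (P.map W.1.1) (condCDFGiven P X.1 W.1.1 x) (D W)} (ρ X W)

/-- There is a law-invariant family of increasing sets `D_W` of functions `S_W → [0,1]` with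
`ρ(X, W) = inf {x : (F_{X | VaR_α(W) ≤ W ≤ VaR_β(W)}(x))_{(α,β) ∈ S_W} ∈ D_W}`.
For `W`, `W'` with the same law, `S_W` and `S_W'` are the same set, and equality of `D_W` and
`D_W'` says that they contain the same functions on it. -/
def HasQuantileBoxForm {Ω : Type*} [MeasurableSpace Ω] {P : Measure Ω} [IsProbabilityMeasure P]
    {N : ℕ} {Y : Set (RandomVector Ω N)} (ρ : LInfty P → Y → ℝ) : Prop :=
  ∃ D : (W : Y) → Set (boxIndex P W.1.1 → unitInterval),
    (∀ W, IsIncreasing (D W)) ∧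
    (∀ (W W' : Y) (h : IdentDistrib W.1.1 W'.1.1 P P) (f : boxIndex P W'.1.1 → unitInterval),
      (fun p : boxIndex P W.1.1 => f ⟨p.1, boxIndex_eq_of_identDistrib h ▸ p.2⟩) ∈ D W ↔
        f ∈ D W') ∧
    ∀ (X : LInfty P) (W : Y), IsGLB {x : ℝ | boxCDF P X.1 W.1.1 x ∈ D W} (ρ X W)

end

end FactorRisk

/-!
For `A` an event, `factorLaw P A W` is the measure `T ↦ P(A ∩ {W ∈ T})` on `ℝ^N`. Both
representations of `ρ` say that `ρ(X, W)` is the infimum of the levels `x` at which the measure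
`factorLaw P {X ≤ x} W` passes a criterion that is monotone and depends on the law of `W` only: the
conditional distribution function is the density of this measure with respect to the law of `W`
(`withDensity_condCDFGiven`), and the values on quantile boxes are its proportions of that law
(`boxCDF_eq_boxRatio`). Such a criterion gives the three axioms (`axioms_of_isGLB`).

For the converse, affine transformations show that ordinality and monotonicity reduce `ρ(X, W)` to
the risks of the indicators of `{X > x}` (`isGLB_lossOff`), and these risks vanish or are at least
`1`. It remains to see that whether the risk of `1_{Aᶜ}` vanishes is a monotone function of
`factorLaw P A W` (`factorLaw_mem_acceptedLaws_iff`). Conditionally on `W` there need not be any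
randomness left, so an event `B` with a larger conditional probability than `A` need not contain a
copy of `A`. But the factor may be replaced by another one with the same law, by law invariance of
`ρ` and of its domain, and an atomless space carries a factor of the given law together with nested
events of the two given conditional probabilities (`exists_nested_events`). This rests on the
existence of a uniform random variable (`exists_uniform`), obtained from a maximal chain of
measurable sets modulo null sets.

For the second representation it is needed in addition that quantile boxes detect the order of
measures dominated by the law of `W` (`le_of_valueBox_le`). A closed box is the increasing union of
quantile boxes up to a null set, closed boxes with equal sides are the balls of the supremum norm,
and the Besicovitch differentiation theorem recovers the densities from the values on balls.
-/

namespace FactorRisk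

open Filter Set
open scoped ENNReal Topology unitInterval

/-! ### Random elements of an atomless space -/

section Atomless

variable {Ω : Type*} [MeasurableSpace Ω] (P : Measure Ω)

/-- The measurable sets, ordered by inclusion up to null sets, form a preorder; this is a maximal
chain of it. -/
def aeFlag : Set {A : Set Ω // MeasurableSet A} :=
  maxChain fun A B => A.1 ≤ᵐ[P] B.1

variable {P}

lemma mem_aeFlag {A : {A : Set Ω // MeasurableSet A}}
    (h : ∀ C ∈ aeFlag P, A.1 ≤ᵐ[P] C.1 ∨ C.1 ≤ᵐ[P] A.1) : A ∈ aeFlag P := by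
  have hmax : IsMaxChain (fun A B : {A : Set Ω // MeasurableSet A} => A.1 ≤ᵐ[P] B.1) (aeFlag P) :=
    maxChain_spec
  have hins := hmax.1.insert (a := A) fun C hC _ => h C hC
  rw [hmax.2 hins (subset_insert _ _)]
  exact mem_insert _ _

lemma aeFlag_total {A B : {A : Set Ω // MeasurableSet A}} (hA : A ∈ aeFlag P) (hB : B ∈ aeFlag P) :
    A.1 ≤ᵐ[P] B.1 ∨ B.1 ≤ᵐ[P] A.1 := by
  by_cases h : A = B
  · exact Or.inl (h ▸ EventuallyLE.refl _ _)
  · exact maxChain_spec.1 hA hB h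

lemma aeFlag_le_of_measure_le [IsFiniteMeasure P] {A B : {A : Set Ω // MeasurableSet A}}
    (hA : A ∈ aeFlag P) (hB : B ∈ aeFlag P) (h : P A.1 ≤ P B.1) : A.1 ≤ᵐ[P] B.1 := by
  rcases aeFlag_total hA hB with h1 | h1
  · exact h1
  · exact (ae_eq_of_ae_subset_of_measure_ge h1 h B.2.nullMeasurableSet
      (measure_ne_top _ _)).symm.le

lemma aeFlag_empty : (⟨∅, .empty⟩ : {A : Set Ω // MeasurableSet A}) ∈ aeFlag P :=
  mem_aeFlag fun C _ => Or.inl (LE.le.eventuallyLE (empty_subset C.1))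

lemma aeFlag_univ : (⟨univ, .univ⟩ : {A : Set Ω // MeasurableSet A}) ∈ aeFlag P :=
  mem_aeFlag fun C _ => Or.inr (LE.le.eventuallyLE (subset_univ C.1))

/-- Among the members of the flag of measure at most `t` there is one of largest measure. -/
lemma exists_aeFlag_isGreatest [IsFiniteMeasure P] (t : ℝ≥0∞) :
    ∃ L ∈ aeFlag P, P L.1 ≤ t ∧ ∀ C ∈ aeFlag P, P C.1 ≤ t → P C.1 ≤ P L.1 := by
  set S : Set ℝ≥0∞ := (fun C => P C.1) '' {C | C ∈ aeFlag P ∧ P C.1 ≤ t}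
  have hS : S.Nonempty := ⟨_, ⟨∅, .empty⟩, ⟨aeFlag_empty, by simp⟩, rfl⟩
  obtain ⟨u, humono, hulim, huS⟩ := exists_seq_tendsto_sSup hS (OrderTop.bddAbove S)
  choose C hC hCu using huS
  simp only at hCu
  have hCle : ∀ k n, k ≤ n → (C k).1 ≤ᵐ[P] (C n).1 := fun k n hkn =>
    aeFlag_le_of_measure_le (hC k).1 (hC n).1 (by rw [hCu, hCu]; exact humono hkn)
  have hlim := tendsto_measure_iUnion_accumulate (μ := P) (f := fun n => (C n).1)
  have hacc : ∀ n, P (accumulate (fun n => (C n).1) n) = u n := by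
    intro n
    rw [← hCu]
    refine le_antisymm (measure_mono_ae ?_)
      (measure_mono (subset_accumulate (s := fun n => (C n).1)))
    have hall : ∀ᵐ ω ∂P, ∀ k, k ≤ n → ω ∈ (C k).1 → ω ∈ (C n).1 := by
      rw [ae_all_iff]
      intro k
      by_cases hk : k ≤ n
      · filter_upwards [hCle k n hk] with ω hω _ using hω
      · simp [hk]
    filter_upwards [hall] with ω hω h
    obtain ⟨k, hk, hωk⟩ := mem_accumulate.1 h
    exact hω k hk hωk
  have hPL : P (⋃ n, (C n).1) = sSup S :=
    tendsto_nhds_unique hlim (by simpa only [hacc] using hulim)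
  refine ⟨⟨⋃ n, (C n).1, .iUnion fun n => (C n).2⟩, mem_aeFlag fun B hB => ?_, ?_, ?_⟩
  · by_cases h : ∃ n, B.1 ≤ᵐ[P] (C n).1
    · obtain ⟨n, hn⟩ := h
      exact Or.inr (hn.trans (LE.le.eventuallyLE (subset_iUnion (fun n => (C n).1) n)))
    · left
      have h2 : ∀ᵐ ω ∂P, ∀ n, ω ∈ (C n).1 → ω ∈ B.1 := ae_all_iff.2 fun n =>
        (aeFlag_total (hC n).1 hB).resolve_right fun h' => h ⟨n, h'⟩
      filter_upwards [h2] with ω hω h3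
      obtain ⟨n, hn⟩ := mem_iUnion.1 h3
      exact hω n hn
  · rw [hPL]
    exact sSup_le (by rintro _ ⟨B, hB, rfl⟩; exact hB.2)
  · intro B hB hBt
    rw [hPL]
    exact le_sSup ⟨B, ⟨hB, hBt⟩, rfl⟩

/-- Among the members of the flag of measure at least `t` there is one of smallest measure. -/
lemma exists_aeFlag_isLeast [IsFiniteMeasure P] {t : ℝ≥0∞} (ht : t ≤ P univ) :
    ∃ M ∈ aeFlag P, t ≤ P M.1 ∧ ∀ C ∈ aeFlag P, t ≤ P C.1 → P M.1 ≤ P C.1 := by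
  set S : Set ℝ≥0∞ := (fun C => P C.1) '' {C | C ∈ aeFlag P ∧ t ≤ P C.1}
  have hS : S.Nonempty := ⟨_, ⟨univ, .univ⟩, ⟨aeFlag_univ, ht⟩, rfl⟩
  obtain ⟨u, humono, hulim, huS⟩ := exists_seq_tendsto_sInf hS (OrderBot.bddBelow S)
  choose C hC hCu using huS
  simp only at hCu
  have hCle : ∀ k n, k ≤ n → (C n).1 ≤ᵐ[P] (C k).1 := fun k n hkn =>
    aeFlag_le_of_measure_le (hC n).1 (hC k).1 (by rw [hCu, hCu]; exact humono hkn)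
  have hlim := tendsto_measure_iUnion_accumulate (μ := P) (f := fun n => (C n).1ᶜ)
  have hacc : ∀ n, P (accumulate (fun n => (C n).1ᶜ) n) = P univ - u n := by
    intro n
    rw [← hCu, ← measure_compl (C n).2 (measure_ne_top _ _)]
    refine le_antisymm (measure_mono_ae ?_)
      (measure_mono (subset_accumulate (s := fun n => (C n).1ᶜ)))
    have hall : ∀ᵐ ω ∂P, ∀ k, k ≤ n → ω ∈ (C n).1 → ω ∈ (C k).1 := by
      rw [ae_all_iff]
      intro k
      by_cases hk : k ≤ n
      · filter_upwards [hCle k n hk] with ω hω _ using hω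
      · simp [hk]
    filter_upwards [hall] with ω hω h
    obtain ⟨k, hk, hωk⟩ := mem_accumulate.1 h
    exact fun h => hωk (hω k hk h)
  have hPU : P (⋃ n, (C n).1ᶜ) = P univ - sInf S := by
    refine tendsto_nhds_unique hlim ?_
    simp only [hacc]
    exact ENNReal.Tendsto.sub tendsto_const_nhds hulim (Or.inl (measure_ne_top _ _))
  have hPM : P (⋂ n, (C n).1) = sInf S := by
    have h1 : (⋂ n, (C n).1) = (⋃ n, (C n).1ᶜ)ᶜ := by simp
    rw [h1, measure_compl (.iUnion fun n => (C n).2.compl) (measure_ne_top _ _), hPU]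
    exact ENNReal.sub_sub_cancel (measure_ne_top _ _)
      (sInf_le ⟨⟨univ, .univ⟩, ⟨aeFlag_univ, ht⟩, rfl⟩)
  refine ⟨⟨⋂ n, (C n).1, .iInter fun n => (C n).2⟩, mem_aeFlag fun B hB => ?_, ?_, ?_⟩
  · by_cases h : ∃ n, (C n).1 ≤ᵐ[P] B.1
    · obtain ⟨n, hn⟩ := h
      exact Or.inl (EventuallyLE.trans
        (LE.le.eventuallyLE (iInter_subset (fun n => (C n).1) n)) hn)
    · right
      have h2 : ∀ᵐ ω ∂P, ∀ n, ω ∈ B.1 → ω ∈ (C n).1 := ae_all_iff.2 fun n =>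
        (aeFlag_total (hC n).1 hB).resolve_left fun h' => h ⟨n, h'⟩
      filter_upwards [h2] with ω hω h3
      exact mem_iInter.2 fun n => hω n h3
  · rw [hPM]
    exact le_sInf (by rintro _ ⟨B, hB, rfl⟩; exact hB.2)
  · intro B hB hBt
    rw [hPM]
    exact sInf_le ⟨B, ⟨hB, hBt⟩, rfl⟩

/-- The flag of an atomless measure has members of every measure: otherwise the largest member
below the gap could be enlarged by a part of the gap, and the flag would not be maximal. -/
lemma exists_aeFlag_measure_eq [IsFiniteMeasure P] (hP : IsAtomless P) {t : ℝ≥0∞}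
    (ht : t ≤ P univ) : ∃ C ∈ aeFlag P, P C.1 = t := by
  obtain ⟨L, hL, hLt, hLmax⟩ := exists_aeFlag_isGreatest (P := P) t
  obtain ⟨M, hM, hMt, hMmin⟩ := exists_aeFlag_isLeast ht
  by_contra! hne
  have hL' : P L.1 < t := lt_of_le_of_ne hLt (hne L hL)
  have hM' : t < P M.1 := lt_of_le_of_ne hMt (hne M hM).symm
  have hLM : L.1 ≤ᵐ[P] M.1 := aeFlag_le_of_measure_le hL hM (hLt.trans hMt)
  have hpos : 0 < P (M.1 \ L.1) := by
    refine lt_of_lt_of_le ?_ (le_measure_sdiff (μ := P) (s₁ := M.1) (s₂ := L.1))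
    exact tsub_pos_of_lt (hL'.trans hM')
  obtain ⟨B, hBm, hBsub, hB0, hBlt⟩ := hP _ (M.2.diff L.2) hpos
  have hLB : P (L.1 ∪ B) = P L.1 + P B :=
    measure_union (disjoint_sdiff_right.mono_right hBsub) hBm
  have hLB_M : P (L.1 ∪ B) < P M.1 := by
    have h1 : P L.1 + P (M.1 \ L.1) = P M.1 := by
      rw [← measure_union disjoint_sdiff_right (M.2.diff L.2)]
      refine measure_congr ?_
      filter_upwards [hLM] with ω hω
      refine propext ⟨fun h => h.elim hω fun h => h.1, fun h => ?_⟩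
      by_cases h2 : ω ∈ L.1
      · exact Or.inl h2
      · exact Or.inr ⟨h, h2⟩
    rw [hLB, ← h1]
    exact ENNReal.add_lt_add_left (measure_ne_top _ _) hBlt
  have hmem : (⟨L.1 ∪ B, L.2.union hBm⟩ : {A : Set Ω // MeasurableSet A}) ∈ aeFlag P := by
    refine mem_aeFlag fun C hC => ?_
    rcases le_total (P C.1) t with h | h
    · exact Or.inr ((aeFlag_le_of_measure_le hC hL (hLmax C hC h)).trans
        (LE.le.eventuallyLE subset_union_left))
    · left
      have h1 := aeFlag_le_of_measure_le hM hC (hMmin C hC h)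
      filter_upwards [h1, hLM] with ω h2 h3 h4
      exact h2 (h4.elim h3 fun h5 => (hBsub h5).1)
  rcases le_total (P (L.1 ∪ B)) t with h | h
  · have h1 := hLmax _ hmem h
    simp only [hLB] at h1
    exact absurd h1 (not_le.2 (ENNReal.lt_add_right (measure_ne_top _ _) hB0.ne'))
  · exact absurd (hMmin _ hmem h) (not_le.2 hLB_M)

/-- An atomless probability space carries a uniformly distributed random variable: the first
parameter at which a point enters the flag. -/
theorem exists_uniform [IsProbabilityMeasure P] (hP : IsAtomless P) :
    ∃ U : Ω → I, Measurable U ∧ P.map U = volume := by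
  have hex : ∀ t : I, ∃ C ∈ aeFlag P, P C.1 = ENNReal.ofReal t := fun t =>
    exists_aeFlag_measure_eq hP (by simpa using t.2.2)
  choose C hC hCt using hex
  have hCle : ∀ s t : I, s ≤ t → (C s).1 ≤ᵐ[P] (C t).1 := fun s t hst =>
    aeFlag_le_of_measure_le (hC s) (hC t) (by rw [hCt, hCt]; exact ENNReal.ofReal_le_ofReal hst)
  obtain ⟨D, hDc, hDd⟩ := TopologicalSpace.exists_countable_dense I
  let U : Ω → I := fun ω => sInf {q | q ∈ D ∧ ω ∈ (C q).1}
  have hU : ∀ t, U ⁻¹' Iio t = ⋃ q ∈ D ∩ Iio t, (C q).1 := by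
    intro t
    ext ω
    simp only [U, mem_preimage, mem_Iio, sInf_lt_iff, mem_ofPred_eq, mem_iUnion, mem_inter_iff,
      exists_prop]
    exact ⟨fun ⟨q, ⟨h1, h2⟩, h3⟩ => ⟨q, ⟨h1, h3⟩, h2⟩, fun ⟨q, ⟨h1, h3⟩, h2⟩ => ⟨q, ⟨h1, h2⟩, h3⟩⟩
  have hcount : ∀ t, (D ∩ Iio t).Countable := fun t => hDc.mono inter_subset_left
  have hUm : Measurable U := measurable_of_Iio fun t => by
    rw [hU]
    exact .biUnion (hcount t) fun q _ => (C q).2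
  have hPU : ∀ t, P (U ⁻¹' Iio t) = ENNReal.ofReal t := by
    intro t
    rw [hU]
    refine le_antisymm ?_ ?_
    · rw [← hCt]
      refine measure_mono_ae ?_
      have h1 : ∀ᵐ ω ∂P, ∀ q ∈ D ∩ Iio t, ω ∈ (C q).1 → ω ∈ (C t).1 :=
        (ae_ball_iff (hcount t)).2 fun q hq => hCle q t hq.2.le
      filter_upwards [h1] with ω hω h2
      obtain ⟨q, hq, h3⟩ := mem_iUnion₂.1 h2
      exact hω q hq h3
    · refine le_of_forall_lt fun a ha => ?_
      have hafin : a ≠ ∞ := ha.ne_top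
      have ha' : a.toReal < t := (ENNReal.lt_ofReal_iff_toReal_lt hafin).1 ha
      have haI : a.toReal ∈ I := ⟨ENNReal.toReal_nonneg, ha'.le.trans t.2.2⟩
      obtain ⟨q, hqD, hq⟩ := hDd.exists_between (show (⟨a.toReal, haI⟩ : I) < t from ha')
      refine lt_of_lt_of_le ?_
        (measure_mono (subset_biUnion_of_mem (u := fun q => (C q).1) ⟨hqD, hq.2⟩))
      rw [hCt]
      exact (ENNReal.lt_ofReal_iff_toReal_lt hafin).2 hq.1
  refine ⟨U, hUm, ?_⟩
  have : IsProbabilityMeasure (P.map U) := Measure.isProbabilityMeasure_map hUm.aemeasurable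
  refine Measure.ext_of_Ici _ _ fun t => ?_
  rw [← compl_Iio, prob_compl_eq_one_sub measurableSet_Iio, prob_compl_eq_one_sub measurableSet_Iio,
    Measure.map_apply hUm measurableSet_Iio, hPU, unitInterval.volume_Iio]

/-- Every law on a standard Borel space is the law of a random element of a given atomless
probability space. -/
theorem exists_map_eq [IsProbabilityMeasure P] (hP : IsAtomless P) {E : Type*} [MeasurableSpace E]
    [StandardBorelSpace E] (m : Measure E) [IsProbabilityMeasure m] :
    ∃ Z : Ω → E, Measurable Z ∧ P.map Z = m := by
  have : Nonempty E := nonempty_of_isProbabilityMeasure m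
  obtain ⟨U, hU, hUP⟩ := exists_uniform hP
  obtain ⟨f, hf, hfm⟩ := Measure.exists_measurable_map_eq m
  exact ⟨f ∘ U, hf.comp hU, by rw [← Measure.map_map hf hU, hUP, hfm]⟩

end Atomless

/-! ### Distribution of the factor on an event -/

section FactorLaw

variable {Ω E : Type*} [MeasurableSpace Ω] [MeasurableSpace E] {P : Measure Ω}

/-- The distribution of the factor `W` on the event `A`: the measure `T ↦ P(A ∩ {W ∈ T})`. Its
density with respect to the law of `W` is the conditional probability of `A` given `W`. -/
noncomputable def factorLaw (P : Measure Ω) (A : Set Ω) (W : Ω → E) : Measure E :=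
  (P.restrict A).map W

lemma factorLaw_apply {A : Set Ω} {W : Ω → E} (hW : Measurable W) {T : Set E}
    (hT : MeasurableSet T) : factorLaw P A W T = P (W ⁻¹' T ∩ A) := by
  rw [factorLaw, Measure.map_apply hW hT, Measure.restrict_apply (hW hT)]

lemma factorLaw_le_map {A : Set Ω} {W : Ω → E} (hW : Measurable W) :
    factorLaw P A W ≤ P.map W :=
  Measure.map_mono Measure.restrict_le_self hW

lemma factorLaw_univ {W : Ω → E} : factorLaw P univ W = P.map W := by
  rw [factorLaw, Measure.restrict_univ]

lemma factorLaw_mono {A B : Set Ω} {W : Ω → E} (hW : Measurable W) (h : A ≤ᵐ[P] B) :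
    factorLaw P A W ≤ factorLaw P B W :=
  Measure.map_mono (Measure.restrict_mono' h le_rfl) hW

lemma factorLaw_eq_of_identDistrib {X X' : Ω → ℝ} {W W' : Ω → E} (hW : Measurable W)
    (hW' : Measurable W')
    (h : IdentDistrib (fun ω => (X ω, W ω)) (fun ω => (X' ω, W' ω)) P P) (x : ℝ) :
    factorLaw P {ω | X ω ≤ x} W = factorLaw P {ω | X' ω ≤ x} W' := by
  ext T hT
  rw [factorLaw_apply hW hT, factorLaw_apply hW' hT]
  have h1 := h.measure_mem_eq (measurableSet_Iic (a := x) |>.prod hT)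
  convert h1 using 2
  · ext ω; simp [and_comm]
  · ext ω; simp [and_comm]

/-- The conditional distribution function at `x` is the density of the distribution of the factor
on the event `{X ≤ x}`. -/
lemma withDensity_condCDFGiven [IsProbabilityMeasure P] {N : ℕ} {X : Ω → ℝ} {W : Ω → Fin N → ℝ}
    (hX : Measurable X) (hW : Measurable W) (x : ℝ) :
    (P.map W).withDensity (fun w => ENNReal.ofReal (condCDFGiven P X W x w)) =
      factorLaw P {ω | X ω ≤ x} W := by
  ext T hT
  rw [withDensity_apply _ hT, factorLaw_apply hW hT]
  have h1 : ∀ w, ENNReal.ofReal (condCDFGiven P X W x w) = condDistrib X W P w (Iic x) := by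
    intro w
    simp only [condCDFGiven]
    exact ofReal_measureReal
  simp_rw [h1]
  have h2 := congrArg (fun m : Measure ((Fin N → ℝ) × ℝ) => m (T ×ˢ Iic x))
    (compProd_map_condDistrib (μ := P) (X := W) hX.aemeasurable)
  rw [Measure.compProd_apply_prod hT measurableSet_Iic,
    Measure.map_apply (hW.prodMk hX) (hT.prod measurableSet_Iic)] at h2
  exact h2

lemma measurable_condCDFGiven [IsProbabilityMeasure P] {N : ℕ} (X : Ω → ℝ) (W : Ω → Fin N → ℝ)
    (x : ℝ) : Measurable (condCDFGiven P X W x) :=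
  ((Kernel.measurable_coe _ measurableSet_Iic).ennreal_toReal).subtype_mk

/-- Comparability of two sub-laws can be realized by nested events: if `ν₁ ≤ ν₂ ≤ μ`, then an
atomless space carries a random element `W` with law `μ` and events `A ⊆ B` on which `W` has the
distributions `ν₁` and `ν₂`. This needs no randomness beyond a given factor, since the factor
itself is chosen anew. -/
theorem exists_nested_events [IsProbabilityMeasure P] (hP : IsAtomless P) [StandardBorelSpace E]
    {μ ν₁ ν₂ : Measure E} [IsProbabilityMeasure μ] (h₁ : ν₁ ≤ ν₂) (h₂ : ν₂ ≤ μ) :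
    ∃ (W : Ω → E) (A B : Set Ω), Measurable W ∧ MeasurableSet A ∧ MeasurableSet B ∧ A ⊆ B ∧
      P.map W = μ ∧ factorLaw P A W = ν₁ ∧ factorLaw P B W = ν₂ := by
  have : IsFiniteMeasure ν₂ := isFiniteMeasure_of_le μ h₂
  have : IsFiniteMeasure ν₁ := isFiniteMeasure_of_le ν₂ h₁
  have hs₁ : ν₁ + (ν₂ - ν₁) = ν₂ := by rw [add_comm, Measure.sub_add_cancel_of_le h₁]
  have hs₂ : ν₂ + (μ - ν₂) = μ := by rw [add_comm, Measure.sub_add_cancel_of_le h₂]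
  let e : Fin 3 → E → E × Fin 3 := fun i w => (w, i)
  have he : ∀ i, Measurable (e i) := fun i => measurable_id.prodMk measurable_const
  let m : Measure (E × Fin 3) := ν₁.map (e 0) + (ν₂ - ν₁).map (e 1) + (μ - ν₂).map (e 2)
  have hm : ∀ (T : Set (E × Fin 3)), MeasurableSet T →
      m T = ν₁ (e 0 ⁻¹' T) + (ν₂ - ν₁) (e 1 ⁻¹' T) + (μ - ν₂) (e 2 ⁻¹' T) := fun T hT => by
    simp only [m, Measure.coe_add, Pi.add_apply, Measure.map_apply (he _) hT]
  have hmfst : m.map Prod.fst = μ := by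
    ext T hT
    rw [Measure.map_apply measurable_fst hT, hm _ (measurable_fst hT)]
    conv_rhs => rw [← hs₂, Measure.add_apply, ← hs₁, Measure.add_apply]
    simp only [hs₁]
    rfl
  have : IsProbabilityMeasure m := by
    refine ⟨?_⟩
    have h1 : m.map Prod.fst univ = 1 := by rw [hmfst]; exact measure_univ
    rwa [Measure.map_apply measurable_fst MeasurableSet.univ] at h1
  obtain ⟨Z, hZ, hZm⟩ := exists_map_eq hP m
  have hset : ∀ J : Set (Fin 3), MeasurableSet ((Prod.snd : E × Fin 3 → Fin 3) ⁻¹' J) :=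
    fun J => measurable_snd (MeasurableSet.of_discrete)
  have hlaw : ∀ (J : Set (Fin 3)) (T : Set E), MeasurableSet T →
      factorLaw P (Z ⁻¹' (Prod.snd ⁻¹' J)) (fun ω => (Z ω).1) T =
        m (Prod.fst ⁻¹' T ∩ Prod.snd ⁻¹' J) := fun J T hT => by
    rw [factorLaw_apply (W := fun ω => (Z ω).1) (measurable_fst.comp hZ) hT, ← hZm,
      Measure.map_apply hZ ((measurable_fst hT).inter (hset J))]
    rfl
  refine ⟨fun ω => (Z ω).1, Z ⁻¹' (Prod.snd ⁻¹' {0}), Z ⁻¹' (Prod.snd ⁻¹' {0, 1}),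
    measurable_fst.comp hZ, hZ (hset _), hZ (hset _), ?_, ?_, ?_, ?_⟩
  · exact preimage_mono (preimage_mono (by simp))
  · rw [← hmfst, ← hZm, Measure.map_map measurable_fst hZ]
    rfl
  · ext T hT
    rw [hlaw _ _ hT, hm _ ((measurable_fst hT).inter (hset _))]
    simp [e, preimage_inter, preimage_preimage]
  · ext T hT
    rw [hlaw _ _ hT, hm _ ((measurable_fst hT).inter (hset _))]
    conv_rhs => rw [← hs₁, Measure.add_apply]
    simp [e, preimage_inter, preimage_preimage]

end FactorLaw

/-! ### Indicator losses -/

section LossIndicator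

variable {Ω : Type*} [MeasurableSpace Ω] {P : Measure Ω}

/-- The loss that is `0` on the event `A` and `1` off it. -/
noncomputable def lossOff {A : Set Ω} (hA : MeasurableSet A) : LInfty P :=
  ⟨Aᶜ.indicator fun _ => 1, measurable_const.indicator hA.compl,
    memLp_top_of_bound (measurable_const.indicator hA.compl).aestronglyMeasurable 1
      (Eventually.of_forall fun ω => by by_cases h : ω ∈ A <;> simp [h])⟩

/-- The law of the factor and its distribution on `A` determine the joint law of the factor and the
indicator of `Aᶜ`. -/
lemma identDistrib_lossOff [IsProbabilityMeasure P] {E : Type*} [MeasurableSpace E] {A A' : Set Ω}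
    (hA : MeasurableSet A)
    (hA' : MeasurableSet A') {W W' : Ω → E} (hW : Measurable W) (hW' : Measurable W')
    (hlaw : P.map W = P.map W') (h : factorLaw P A W = factorLaw P A' W') :
    IdentDistrib (fun ω => ((lossOff (P := P) hA).1 ω, W ω))
      (fun ω => ((lossOff (P := P) hA').1 ω, W' ω)) P P := by
  have hm : Measurable fun ω => ((lossOff (P := P) hA).1 ω, W ω) :=
    (lossOff (P := P) hA).2.1.prodMk hW
  have hm' : Measurable fun ω => ((lossOff (P := P) hA').1 ω, W' ω) :=
    (lossOff (P := P) hA').2.1.prodMk hW'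
  refine ⟨hm.aemeasurable, hm'.aemeasurable, ?_⟩
  have key : ∀ {B : Set Ω} {V : Ω → E} (hB : MeasurableSet B) (hV : Measurable V)
      (S : Set (ℝ × E)), MeasurableSet S →
      P ((fun ω => ((lossOff (P := P) hB).1 ω, V ω)) ⁻¹' S) =
        factorLaw P B V (Prod.mk 0 ⁻¹' S) +
          (P.map V (Prod.mk 1 ⁻¹' S) - factorLaw P B V (Prod.mk 1 ⁻¹' S)) := by
    intro B V hB hV S hS
    have hS0 : MeasurableSet ((Prod.mk (0 : ℝ) : E → ℝ × E) ⁻¹' S) := measurable_prodMk_left hS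
    have hS1 : MeasurableSet ((Prod.mk (1 : ℝ) : E → ℝ × E) ⁻¹' S) := measurable_prodMk_left hS
    rw [factorLaw_apply hV hS0, factorLaw_apply hV hS1, Measure.map_apply hV hS1,
      ← measure_inter_add_sdiff _ hB]
    congr 1
    · congr 1
      ext ω
      simp only [mem_inter_iff, mem_preimage, and_congr_left_iff]
      intro hω
      simp [lossOff, hω]
    · rw [← measure_inter_add_sdiff (V ⁻¹' (Prod.mk 1 ⁻¹' S)) hB,
        ENNReal.add_sub_cancel_left (measure_ne_top _ _)]
      congr 1
      ext ω
      simp only [Set.mem_sdiff, mem_preimage, and_congr_left_iff]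
      intro hω
      simp [lossOff, hω]
  ext S hS
  rw [Measure.map_apply hm hS, Measure.map_apply hm' hS, key hA hW S hS, key hA' hW' S hS, hlaw, h]

end LossIndicator

/-! ### Consequences of monotonicity and ordinality -/

section Ordinal

variable {Ω : Type*} [MeasurableSpace Ω] {P : Measure Ω} {N : ℕ} {Y : Set (RandomVector Ω N)}
  {ρ : LInfty P → Y → ℝ}

lemma map_zero_of_ordinality (hO : Ordinality ρ) {X : LInfty P} (hX : ∀ ω, X.1 ω = 0) (W : Y) :
    ρ X W = 0 := by
  have h1 := hO (fun t => 2 * t) (by fun_prop) (fun a b h => by simpa using h) X W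
  have h2 : X.comp (fun t => 2 * t) (by fun_prop) = X :=
    Subtype.ext (funext fun ω => by simp [LInfty.comp, hX])
  rw [h2] at h1
  linarith

lemma map_one_of_ordinality (hO : Ordinality ρ) {X : LInfty P} (hX : ∀ ω, X.1 ω = 1) (W : Y) :
    ρ X W = 1 := by
  have h1 := hO (fun t => 2 * t - 1) (by fun_prop) (fun a b h => by simpa using h) X W
  have h2 : X.comp (fun t => 2 * t - 1) (by fun_prop) = X :=
    Subtype.ext (funext fun ω => by simp [LInfty.comp, hX]; norm_num)
  rw [h2] at h1
  linarith

lemma lossOff_nonneg {A : Set Ω} (hA : MeasurableSet A) (ω : Ω) :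
    0 ≤ (lossOff (P := P) hA).1 ω :=
  indicator_nonneg (fun _ _ => zero_le_one) ω

lemma lossOff_risk_nonneg (hM : Monotonicity ρ) (hO : Ordinality ρ) {A : Set Ω}
    (hA : MeasurableSet A) (W : Y) : 0 ≤ ρ (lossOff hA) W := by
  rw [← map_zero_of_ordinality hO (X := lossOff MeasurableSet.univ) (by simp [lossOff]) W]
  refine hM _ _ _ (Eventually.of_forall fun ω => ?_)
  simpa [lossOff] using lossOff_nonneg (P := P) hA ω

/-- A continuous strictly increasing map that fixes `0` and `1` fixes the loss `1_{Aᶜ}`, hence its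
risk; a map that moves every point of `(0, 1)` shows that this risk is not in `(0, 1)`. -/
lemma lossOff_risk_eq_zero_or (hO : Ordinality ρ) (hM : Monotonicity ρ) {A : Set Ω}
    (hA : MeasurableSet A) (W : Y) : ρ (lossOff hA) W = 0 ∨ 1 ≤ ρ (lossOff hA) W := by
  have hφ : StrictMono fun t : ℝ => t + max 0 (min t (1 - t)) / 2 := by
    intro a b hab
    simp only
    rcases max_cases 0 (min a (1 - a)) with h1 | h1 <;>
    rcases max_cases 0 (min b (1 - b)) with h2 | h2 <;>
    rcases min_cases a (1 - a) with h3 | h3 <;>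
    rcases min_cases b (1 - b) with h4 | h4 <;> linarith
  have h1 := hO _ (by fun_prop) hφ (lossOff hA) W
  have h2 : (lossOff (P := P) hA).comp (fun t : ℝ => t + max 0 (min t (1 - t)) / 2)
      (by fun_prop) = lossOff hA := by
    refine Subtype.ext (funext fun ω => ?_)
    by_cases h : ω ∈ A <;> simp [LInfty.comp, lossOff, h]
  rw [h2] at h1
  have h0 := lossOff_risk_nonneg hM hO hA W
  by_contra! h
  have h3 : 0 < min (ρ (lossOff hA) W) (1 - ρ (lossOff hA) W) :=
    lt_min (lt_of_le_of_ne h0 h.1.symm) (by linarith)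
  have h4 := le_max_right 0 (min (ρ (lossOff hA) W) (1 - ρ (lossOff hA) W))
  linarith

lemma LInfty.exists_bound (X : LInfty P) : ∃ C : ℝ, ∀ᵐ ω ∂P, |X.1 ω| ≤ C := by
  have hfin : eLpNormEssSup X.1 P ≠ ⊤ := by
    have h := X.2.2.2
    rw [eLpNorm_exponent_top] at h
    exact h.ne
  refine ⟨(eLpNormEssSup X.1 P).toReal, ?_⟩
  filter_upwards [enorm_ae_le_eLpNormEssSup X.1 P] with ω hω
  simpa [toReal_enorm] using ENNReal.toReal_mono hfin hω

/-- The affine map that is `0` at a lower bound of `X` and `1` at `x` sends `X` to a loss above the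
indicator of `{X > x}`, and its value at `ρ(X) < x` is less than `1`. -/
lemma lossOff_risk_eq_zero_of_lt (hM : Monotonicity ρ) (hO : Ordinality ρ) (X : LInfty P) (W : Y)
    {x : ℝ} (hx : ρ X W < x) (hA : MeasurableSet {ω | X.1 ω ≤ x}) :
    ρ (lossOff hA) W = 0 := by
  obtain ⟨C, hC⟩ := X.exists_bound
  set c := max C (1 - x) with hc
  have hcx : 0 < x + c := by have := le_max_right C (1 - x); linarith
  have h1 := hO (fun t => (t + c) / (x + c)) (by fun_prop)
    (fun a b hab => by simp only; gcongr) X W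
  refine (lossOff_risk_eq_zero_or hO hM hA W).resolve_right fun h2 => ?_
  have h3 : ρ (lossOff hA) W ≤ ρ (X.comp (fun t => (t + c) / (x + c)) (by fun_prop)) W := by
    refine hM _ _ _ ?_
    filter_upwards [hC] with ω hω
    have h4 : 0 ≤ X.1 ω + c := by
      have := (abs_le.1 hω).1
      have := le_max_left C (1 - x)
      linarith
    by_cases h : X.1 ω ≤ x
    · simpa [lossOff, LInfty.comp, h] using div_nonneg h4 hcx.le
    · simp only [lossOff, LInfty.comp, mem_compl_iff, mem_ofPred_eq, h, not_false_eq_true,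
        indicator_of_mem]
      rw [one_le_div hcx]
      linarith
  have h5 : (ρ X W + c) / (x + c) < 1 := by rw [div_lt_one hcx]; linarith
  linarith

/-- The affine map that is `0` at `x` and `1` at an upper bound of `X` sends `X` to a loss below the
indicator of `{X > x}`, and its value at `ρ(X) > x` is positive. -/
lemma lossOff_risk_ne_zero_of_lt (hM : Monotonicity ρ) (hO : Ordinality ρ) (X : LInfty P) (W : Y)
    {x : ℝ} (hx : x < ρ X W) (hA : MeasurableSet {ω | X.1 ω ≤ x}) :
    ρ (lossOff hA) W ≠ 0 := by
  obtain ⟨C, hC⟩ := X.exists_bound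
  set c := max C (1 + x) with hc
  have hcx : 0 < c - x := by have := le_max_right C (1 + x); linarith
  have h1 := hO (fun t => (t - x) / (c - x)) (by fun_prop)
    (fun a b hab => by simp only; gcongr) X W
  have h3 : ρ (X.comp (fun t => (t - x) / (c - x)) (by fun_prop)) W ≤ ρ (lossOff hA) W := by
    refine hM _ _ _ ?_
    filter_upwards [hC] with ω hω
    have h4 : X.1 ω ≤ c := (abs_le.1 hω).2.trans (le_max_left C (1 + x))
    by_cases h : X.1 ω ≤ x
    · simpa [lossOff, LInfty.comp, h] using div_nonpos_of_nonpos_of_nonneg (sub_nonpos.2 h) hcx.le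
    · simp only [lossOff, LInfty.comp, mem_compl_iff, mem_ofPred_eq, h, not_false_eq_true,
        indicator_of_mem]
      rw [div_le_one hcx]
      linarith
  have h5 : 0 < (ρ X W - x) / (c - x) := div_pos (sub_pos.2 hx) hcx
  rw [h1] at h3
  exact (h5.trans_le h3).ne'

/-- The risk `ρ(X, W)` is determined by the risks of the indicators of the events `{X > x}`. -/
lemma isGLB_lossOff (hM : Monotonicity ρ) (hO : Ordinality ρ) (X : LInfty P) (W : Y) :
    IsGLB {x : ℝ | ρ (lossOff (measurableSet_le X.2.1 (measurable_const (a := x)))) W = 0}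
      (ρ X W) := by
  refine ⟨fun x hx => ?_, fun b hb => ?_⟩
  · by_contra! h
    exact lossOff_risk_ne_zero_of_lt hM hO X W h _ hx
  · refine le_of_forall_gt_imp_ge_of_dense fun x hx => ?_
    exact hb (lossOff_risk_eq_zero_of_lt hM hO X W hx _)

end Ordinal

/-! ### Comparison of measures on quantile boxes -/

section Comparison

/-- Sub-laws of a finite measure on `ℝ^N` are compared by their values on cubes: closed balls of
the supremum norm are cubes, and Besicovitch differentiation recovers the densities from them. -/
lemma le_of_closedBall_le {N : ℕ} {μ ν ν' : Measure (Fin N → ℝ)} [IsFiniteMeasure μ]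
    (hν : ν ≤ μ) (hν' : ν' ≤ μ)
    (h : ∀ x r, 0 < r → ν (Metric.closedBall x r) ≤ ν' (Metric.closedBall x r)) : ν ≤ ν' := by
  have : IsFiniteMeasure ν := isFiniteMeasure_of_le μ hν
  have : IsFiniteMeasure ν' := isFiniteMeasure_of_le μ hν'
  have : ν.HaveLebesgueDecomposition μ := Measure.haveLebesgueDecomposition_of_sigmaFinite ν μ
  have : ν'.HaveLebesgueDecomposition μ := Measure.haveLebesgueDecomposition_of_sigmaFinite ν' μ
  rw [← Measure.withDensity_rnDeriv_eq ν μ (Measure.absolutelyContinuous_of_le hν),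
    ← Measure.withDensity_rnDeriv_eq ν' μ (Measure.absolutelyContinuous_of_le hν')]
  refine withDensity_mono ?_
  filter_upwards [Besicovitch.ae_tendsto_rnDeriv ν μ, Besicovitch.ae_tendsto_rnDeriv ν' μ]
    with x h1 h2
  refine le_of_tendsto_of_tendsto h1 h2 ?_
  filter_upwards [self_mem_nhdsWithin] with r hr
  exact ENNReal.div_le_div_right (h x r hr) _

variable {Ω : Type*} [MeasurableSpace Ω] {P : Measure Ω}

lemma VaR_mono (Z : Ω → ℝ) {α α' : ℝ} (h : α ≤ α') : VaR P Z α ≤ VaR P Z α' :=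
  sInf_le_sInf (image_mono fun _ hx => h.trans hx)

/-- An interval of positive probability is, up to a null set, the increasing union of quantile
intervals. The levels of the left ends decrease to `P(Z < a)`; the limit level itself can give a
quantile to the left of `a`. -/
lemma exists_quantile_levels [IsProbabilityMeasure P] {Z : Ω → ℝ} (hZ : Measurable Z) {a b : ℝ}
    (hpos : P.map Z (Icc a b) ≠ 0) :
    ∃ (α : ℕ → ℝ) (β : ℝ), Antitone α ∧ (∀ n, α n ∈ Ioo 0 1) ∧ β ∈ Ioc 0 1 ∧
      (∀ n, ((a : ℝ) : EReal) ≤ VaR P Z (α n)) ∧ VaR P Z β ≤ ((b : ℝ) : EReal) ∧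
      ∀ᵐ x ∂(P.map Z), x ∈ Icc a b →
        (∀ᶠ n in atTop, VaR P Z (α n) ≤ ((x : ℝ) : EReal)) ∧ ((x : ℝ) : EReal) ≤ VaR P Z β := by
  have : IsProbabilityMeasure (P.map Z) := Measure.isProbabilityMeasure_map hZ.aemeasurable
  set m := P.map Z with hm
  set c := m.real (Iio a) with hc
  have hpos' : 0 < m.real (Icc a b) := by
    rw [measureReal_def]
    exact ENNReal.toReal_pos hpos (measure_ne_top _ _)
  have hc0 : 0 ≤ c := measureReal_nonneg
  have hc1 : c < 1 := by
    have h1 : m.real (Iio a ∪ Icc a b) = c + m.real (Icc a b) :=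
      measureReal_union (by
        rw [Set.disjoint_left]
        intro x hx hx'
        exact absurd hx'.1 (not_le.2 hx)) measurableSet_Icc
    have h2 : m.real (Iio a ∪ Icc a b) ≤ 1 := measureReal_le_one
    linarith
  have hβ : 0 < cdf m b := by
    rw [cdf_eq_real]
    exact hpos'.trans_le (measureReal_mono Icc_subset_Iic_self)
  have hstep : ∀ n : ℕ, 0 < (1 - c) / (n + 2) := fun n =>
    div_pos (by linarith) (by positivity)
  have hcdf_lt : ∀ y, y < a → cdf m y ≤ c := fun y hy => by
    rw [cdf_eq_real]
    exact measureReal_mono (fun z hz => lt_of_le_of_lt hz hy)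
  refine ⟨fun n => c + (1 - c) / (n + 2), cdf m b, ?_, ?_, ⟨hβ, cdf_le_one _ _⟩, ?_, ?_, ?_⟩
  · intro n k hnk
    have h1 : (0 : ℝ) ≤ 1 - c := by linarith
    have h2 : (n : ℝ) ≤ k := by exact_mod_cast hnk
    simp only
    gcongr
  · intro n
    have h1 := hstep n
    refine ⟨by simp only; linarith, ?_⟩
    have h2 : (1 - c) / ((n : ℝ) + 2) < 1 - c :=
      div_lt_self (by linarith) (by have : (0 : ℝ) ≤ n := n.cast_nonneg; linarith)
    simp only
    linarith
  · intro n
    refine le_sInf ?_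
    rintro _ ⟨y, hy, rfl⟩
    refine EReal.coe_le_coe_iff.2 ?_
    by_contra! h
    have h1 := hcdf_lt y h
    have h2 : c + (1 - c) / (n + 2) ≤ cdf m y := hy
    have h3 := hstep n
    linarith
  · exact sInf_le ⟨b, le_refl (cdf m b), rfl⟩
  · -- The points of `[a, b]` at which the distribution function has not yet exceeded `P(Z < a)`.
    have hleft : m {x | a ≤ x ∧ cdf m x ≤ c} = 0 := by
      have hnull : ∀ y, a ≤ y → cdf m y ≤ c → m (Icc a y) = 0 := by
        intro y hay hy
        have h1 : m.real (Iio a ∪ Icc a y) = c + m.real (Icc a y) :=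
          measureReal_union (by
            rw [Set.disjoint_left]
            intro x hx hx'
            exact absurd hx'.1 (not_le.2 hx)) measurableSet_Icc
        have h2 : m.real (Iio a ∪ Icc a y) ≤ cdf m y := by
          rw [cdf_eq_real]
          exact measureReal_mono (union_subset (fun z hz => (le_of_lt hz).trans hay)
            Icc_subset_Iic_self)
        have h3 : m.real (Icc a y) = 0 := le_antisymm (by linarith) measureReal_nonneg
        exact (measureReal_eq_zero_iff (measure_ne_top _ _)).1 h3
      refine measure_null_of_locally_null _ fun x hx => ?_
      by_cases h : ∃ y, x < y ∧ cdf m y ≤ c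
      · obtain ⟨y, hxy, hy⟩ := h
        refine ⟨Icc a y, ?_, hnull y (hx.1.trans hxy.le) hy⟩
        filter_upwards [self_mem_nhdsWithin, mem_nhdsWithin_of_mem_nhds (Iio_mem_nhds hxy)]
          with z hz hz'
        exact ⟨hz.1, le_of_lt hz'⟩
      · push Not at h
        refine ⟨Icc a x, ?_, hnull x hx.1 hx.2⟩
        filter_upwards [self_mem_nhdsWithin] with z hz
        exact ⟨hz.1, not_lt.1 fun h' => absurd hz.2 (not_le.2 (h z h'))⟩
    -- The points of `[a, b]` to the right of the first point where the value at `b` is reached.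
    have hright : m {x | x ≤ b ∧ ∃ y, y < x ∧ cdf m b ≤ cdf m y} = 0 := by
      refine measure_null_of_locally_null _ ?_
      rintro x ⟨hxb, y, hyx, hy⟩
      refine ⟨Ioc y b, ?_, ?_⟩
      · filter_upwards [self_mem_nhdsWithin, mem_nhdsWithin_of_mem_nhds (Ioi_mem_nhds hyx)]
          with z hz hz'
        exact ⟨hz', hz.1⟩
      · have h1 : m.real (Iic y ∪ Ioc y b) = m.real (Iic y) + m.real (Ioc y b) :=
          measureReal_union (by
            rw [Set.disjoint_left]
            intro z hz hz'
            exact absurd hz'.1 (not_lt.2 hz)) measurableSet_Ioc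
        rw [Iic_union_Ioc_eq_Iic (hyx.le.trans hxb)] at h1
        rw [cdf_eq_real, cdf_eq_real] at hy
        have h3 : m.real (Ioc y b) = 0 := le_antisymm (by linarith) measureReal_nonneg
        exact (measureReal_eq_zero_iff (measure_ne_top _ _)).1 h3
    have hleft' := measure_eq_zero_iff_ae_notMem.1 hleft
    have hright' := measure_eq_zero_iff_ae_notMem.1 hright
    filter_upwards [hleft', hright'] with x h1 h2 hx
    have h1' : c < cdf m x := not_le.1 fun h => h1 ⟨hx.1, h⟩
    constructor
    · have hlim : Tendsto (fun n : ℕ => c + (1 - c) / ((n : ℝ) + 2)) atTop (𝓝 (c + 0)) :=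
        tendsto_const_nhds.add (tendsto_const_nhds.div_atTop
          (tendsto_natCast_atTop_atTop.atTop_add tendsto_const_nhds))
      rw [add_zero] at hlim
      filter_upwards [hlim.eventually_le_const h1'] with n hn
      exact sInf_le ⟨x, hn, rfl⟩
    · refine le_sInf ?_
      rintro _ ⟨y, hy, rfl⟩
      refine EReal.coe_le_coe_iff.2 ?_
      by_contra! h
      exact h2 ⟨hx.2, y, h, hy⟩

/-- The set of values of the factor on the quantile box: the box is the event that `W` is in it. -/
def valueBox (P : Measure Ω) {N : ℕ} (W : Ω → Fin N → ℝ) (α β : Fin N → ℝ) : Set (Fin N → ℝ) :=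
  {w | ∀ i, VaR P (fun ω => W ω i) (α i) ≤ (w i : EReal) ∧
    (w i : EReal) ≤ VaR P (fun ω => W ω i) (β i)}

lemma measurableSet_valueBox {N : ℕ} (W : Ω → Fin N → ℝ) (α β : Fin N → ℝ) :
    MeasurableSet (valueBox P W α β) := by
  rw [valueBox, Set.ofPred_forall]
  refine MeasurableSet.iInter fun i => ?_
  have hm : Measurable fun w : Fin N → ℝ => ((w i : ℝ) : EReal) :=
    measurable_coe_real_ereal.comp (measurable_pi_apply i)
  exact (measurableSet_le measurable_const hm).inter (measurableSet_le hm measurable_const)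

lemma map_valueBox {N : ℕ} {W : Ω → Fin N → ℝ} (hW : Measurable W) (α β : Fin N → ℝ) :
    P.map W (valueBox P W α β) = P (quantileBox P W α β) :=
  Measure.map_apply hW (measurableSet_valueBox W α β)

lemma valueBox_eq_of_map_eq {N : ℕ} {W W' : Ω → Fin N → ℝ} (hW : Measurable W)
    (hW' : Measurable W') (h : P.map W = P.map W') (α β : Fin N → ℝ) :
    valueBox P W α β = valueBox P W' α β := by
  have hV : ∀ i t, VaR P (fun ω' => W ω' i) t = VaR P (fun ω' => W' ω' i) t := by
    intro i t
    have h' : P.map (fun ω' => W ω' i) = P.map (fun ω' => W' ω' i) := by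
      have h1 := congrArg (fun m : Measure (Fin N → ℝ) => m.map fun w => w i) h
      simpa only [Measure.map_map (measurable_pi_apply i) hW,
        Measure.map_map (measurable_pi_apply i) hW', Function.comp_def] using h1
    simp only [VaR, h']
  simp only [valueBox, hV]

/-- Sub-laws of the factor are compared by their values on the quantile boxes of positive
probability. -/
theorem le_of_valueBox_le [IsProbabilityMeasure P] {N : ℕ} {W : Ω → Fin N → ℝ} (hW : Measurable W)
    {ν ν' : Measure (Fin N → ℝ)} (hν : ν ≤ P.map W) (hν' : ν' ≤ P.map W)
    (h : ∀ p ∈ boxIndex P W, ν (valueBox P W p.1 p.2) ≤ ν' (valueBox P W p.1 p.2)) : ν ≤ ν' := by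
  have : IsProbabilityMeasure (P.map W) := Measure.isProbabilityMeasure_map hW.aemeasurable
  refine le_of_closedBall_le hν hν' fun x r hr => ?_
  have hball : Metric.closedBall x r = {w | ∀ i, w i ∈ Icc (x i - r) (x i + r)} := by
    ext w
    simp only [Metric.mem_closedBall, dist_pi_le_iff hr.le, mem_ofPred_eq, ← Real.closedBall_eq_Icc]
  have hWi : ∀ i, Measurable fun ω => W ω i := fun i => (measurable_pi_apply i).comp hW
  have hmap : ∀ i, P.map (fun ω => W ω i) = (P.map W).map fun w => w i := fun i => by
    rw [Measure.map_map (measurable_pi_apply i) hW]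
    rfl
  by_cases hpos : ∀ i, P.map (fun ω => W ω i) (Icc (x i - r) (x i + r)) ≠ 0
  · choose α β hα hα01 hβ01 hαa hβb hae using fun i => exists_quantile_levels (hWi i) (hpos i)
    set Q : ℕ → Set (Fin N → ℝ) := fun n => valueBox P W (fun i => α i n) β with hQ
    have hQmono : Monotone Q := fun n k hnk w hw i =>
      ⟨(VaR_mono _ (hα i hnk)).trans (hw i).1, (hw i).2⟩
    have hQball : ∀ n, Q n ⊆ Metric.closedBall x r := fun n w hw => by
      rw [hball]
      exact fun i => ⟨EReal.coe_le_coe_iff.1 ((hαa i n).trans (hw i).1),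
        EReal.coe_le_coe_iff.1 ((hw i).2.trans (hβb i))⟩
    have hcover : ∀ᵐ w ∂(P.map W), w ∈ Metric.closedBall x r → w ∈ ⋃ n, Q n := by
      have h1 : ∀ᵐ w ∂(P.map W), ∀ i, w i ∈ Icc (x i - r) (x i + r) →
          (∀ᶠ n in atTop, VaR P (fun ω => W ω i) (α i n) ≤ ((w i : ℝ) : EReal)) ∧
            ((w i : ℝ) : EReal) ≤ VaR P (fun ω => W ω i) (β i) := by
        refine ae_all_iff.2 fun i => ?_
        have h2 := hae i
        rw [hmap i] at h2
        exact ae_of_ae_map (measurable_pi_apply i).aemeasurable h2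
      filter_upwards [h1] with w hw hwb
      rw [hball] at hwb
      obtain ⟨n, hn⟩ := (eventually_all.2 fun i => (hw i (hwb i)).1).exists
      exact mem_iUnion.2 ⟨n, fun i => ⟨hn i, (hw i (hwb i)).2⟩⟩
    calc ν (Metric.closedBall x r) ≤ ν (⋃ n, Q n) :=
          measure_mono_ae ((Measure.absolutelyContinuous_of_le hν).ae_le hcover)
      _ = ⨆ n, ν (Q n) := hQmono.measure_iUnion
      _ ≤ ν' (Metric.closedBall x r) := by
          refine iSup_le fun n => le_trans ?_ (measure_mono (hQball n))
          by_cases h0 : P.map W (Q n) = 0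
          · exact ((hν _).trans h0.le).trans (zero_le)
          · refine h (fun i => α i n, β) ⟨fun i => hα01 i n, hβ01, ?_⟩
            rw [← map_valueBox hW]
            exact pos_iff_ne_zero.2 h0
  · push Not at hpos
    obtain ⟨i, hi⟩ := hpos
    refine le_trans ((hν _).trans (le_of_eq ?_)) (zero_le)
    rw [hmap i, Measure.map_apply (measurable_pi_apply i) measurableSet_Icc] at hi
    refine measure_mono_null ?_ hi
    rw [hball]
    exact fun w hw => hw i

end Comparison

/-! ### Acceptable sub-laws -/

section Acceptance

variable {Ω : Type*} [MeasurableSpace Ω] {P : Measure Ω} {N : ℕ} {Y : Set (RandomVector Ω N)}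
  {ρ : LInfty P → Y → ℝ}

lemma identDistrib_of_map_eq {W W' : RandomVector Ω N} (h : P.map W.1 = P.map W'.1) :
    IdentDistrib W.1 W'.1 P P :=
  ⟨W.2.aemeasurable, W'.2.aemeasurable, h⟩

/-- The sub-laws of the factor that are acceptable for `ρ`: those above the distribution of a
factor with the same law on an event `A` for which the loss `1_{Aᶜ}` has risk `0`. -/
def acceptedLaws (ρ : LInfty P → Y → ℝ) (W : Y) : Set (Measure (Fin N → ℝ)) :=
  {ν | ν ≤ P.map W.1.1 ∧ ∃ (W' : Y) (A : Set Ω) (hA : MeasurableSet A),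
    P.map W'.1.1 = P.map W.1.1 ∧ factorLaw P A W'.1.1 ≤ ν ∧ ρ (lossOff hA) W' = 0}

lemma acceptedLaws_eq {W W' : Y} (h : P.map W.1.1 = P.map W'.1.1) :
    acceptedLaws ρ W = acceptedLaws ρ W' := by
  simp only [acceptedLaws, h]

lemma acceptedLaws_upper {W : Y} {ν ν' : Measure (Fin N → ℝ)} (hν : ν ∈ acceptedLaws ρ W)
    (h : ν ≤ ν') (h' : ν' ≤ P.map W.1.1) : ν' ∈ acceptedLaws ρ W := by
  obtain ⟨-, W', A, hA, h1, h2, h3⟩ := hν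
  exact ⟨h', W', A, hA, h1, h2.trans h, h3⟩

/-- Acceptability of an event depends on the distribution of the factor on it only, and is monotone
in this distribution: the two events to be compared are realized anew as nested events, for a
factor with the same law. -/
lemma factorLaw_mem_acceptedLaws_iff [IsProbabilityMeasure P] (hP : IsAtomless P)
    (hY : IsLawInvariantSet P Y) (hM : Monotonicity ρ) (hO : Ordinality ρ) (hL : LawInvariance ρ)
    (W : Y) {B : Set Ω} (hB : MeasurableSet B) :
    factorLaw P B W.1.1 ∈ acceptedLaws ρ W ↔ ρ (lossOff hB) W = 0 := by
  refine ⟨?_, fun h => ⟨factorLaw_le_map W.1.2, W, B, hB, rfl, le_rfl, h⟩⟩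
  rintro ⟨-, W', A, hA, hlaw, hle, hzero⟩
  have : IsProbabilityMeasure (P.map W.1.1) :=
    Measure.isProbabilityMeasure_map W.1.2.aemeasurable
  obtain ⟨V, A', B', hV, hA', hB', hAB, hVlaw, hVA, hVB⟩ :=
    exists_nested_events hP hle (factorLaw_le_map (P := P) (A := B) W.1.2)
  let V' : RandomVector Ω N := ⟨V, hV⟩
  have hV' : V' ∈ Y := hY W.1 W.2 V' (identDistrib_of_map_eq hVlaw)
  have h1 : ρ (lossOff hA') ⟨V', hV'⟩ = ρ (lossOff hA) W' :=
    hL _ _ _ _ (identDistrib_lossOff hA' hA hV W'.1.2 (hVlaw.trans hlaw.symm) hVA)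
  have h2 : ρ (lossOff hB') ⟨V', hV'⟩ = ρ (lossOff hB) W :=
    hL _ _ _ _ (identDistrib_lossOff hB' hB hV W.1.2 hVlaw hVB)
  have h3 : ρ (lossOff hB') ⟨V', hV'⟩ ≤ ρ (lossOff hA') ⟨V', hV'⟩ :=
    hM _ _ _ (Eventually.of_forall fun ω =>
      indicator_le_indicator_of_subset (compl_subset_compl.2 hAB) (fun _ => zero_le_one) ω)
  rw [h1, h2, hzero] at h3
  exact le_antisymm h3 (lossOff_risk_nonneg hM hO hB W)

lemma map_mem_acceptedLaws [IsProbabilityMeasure P] (hP : IsAtomless P)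
    (hY : IsLawInvariantSet P Y) (hM : Monotonicity ρ) (hO : Ordinality ρ) (hL : LawInvariance ρ)
    (W : Y) : P.map W.1.1 ∈ acceptedLaws ρ W := by
  rw [← factorLaw_univ (P := P), factorLaw_mem_acceptedLaws_iff hP hY hM hO hL W .univ]
  exact map_zero_of_ordinality hO (by simp [lossOff]) W

lemma zero_notMem_acceptedLaws [IsProbabilityMeasure P] (hP : IsAtomless P)
    (hY : IsLawInvariantSet P Y) (hM : Monotonicity ρ) (hO : Ordinality ρ) (hL : LawInvariance ρ)
    (W : Y) : 0 ∉ acceptedLaws ρ W := by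
  have h0 : factorLaw P ∅ W.1.1 = 0 := by simp [factorLaw]
  rw [← h0, factorLaw_mem_acceptedLaws_iff hP hY hM hO hL W .empty,
    map_one_of_ordinality hO (by simp [lossOff]) W]
  exact one_ne_zero

lemma isGLB_acceptedLaws [IsProbabilityMeasure P] (hP : IsAtomless P)
    (hY : IsLawInvariantSet P Y) (hM : Monotonicity ρ) (hO : Ordinality ρ) (hL : LawInvariance ρ)
    (X : LInfty P) (W : Y) :
    IsGLB {x : ℝ | factorLaw P {ω | X.1 ω ≤ x} W.1.1 ∈ acceptedLaws ρ W} (ρ X W) := by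
  simp only [fun x => factorLaw_mem_acceptedLaws_iff hP hY hM hO hL W
    (measurableSet_le X.2.1 (measurable_const (a := x)))]
  exact isGLB_lossOff hM hO X W

/-- The converse for a general acceptance criterion: if `ρ(X, W)` is the infimum of the levels `x`
at which the distribution of the factor on `{X ≤ x}` belongs to a family, increasing and depending
on the law of the factor only, then the axioms hold. -/
theorem axioms_of_isGLB {G : Y → Set (Measure (Fin N → ℝ))}
    (hlaw : ∀ W W' : Y, P.map W.1.1 = P.map W'.1.1 → G W = G W')
    (hup : ∀ (W : Y) (A B : Set Ω), MeasurableSet A → MeasurableSet B →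
      factorLaw P A W.1.1 ≤ factorLaw P B W.1.1 →
        factorLaw P A W.1.1 ∈ G W → factorLaw P B W.1.1 ∈ G W)
    (hglb : ∀ (X : LInfty P) (W : Y),
      IsGLB {x : ℝ | factorLaw P {ω | X.1 ω ≤ x} W.1.1 ∈ G W} (ρ X W)) :
    Monotonicity ρ ∧ Ordinality ρ ∧ LawInvariance ρ := by
  have hmeas : ∀ (X : LInfty P) (x : ℝ), MeasurableSet {ω | X.1 ω ≤ x} := fun X x =>
    measurableSet_le X.2.1 measurable_const
  refine ⟨fun X X' W h => ?_, fun φ hφ hmono X W => ?_, fun X X' W W' h => ?_⟩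
  · refine (hglb X' W).mono (hglb X W) fun x hx => hup W _ _ (hmeas X' x) (hmeas X x) ?_ hx
    refine factorLaw_mono W.1.2 ?_
    filter_upwards [h] with ω hω h' using hω.trans h'
  · have hzero : factorLaw P ∅ W.1.1 ∉ G W := by
      intro h0
      have huniv : {x : ℝ | factorLaw P {ω | X.1 ω ≤ x} W.1.1 ∈ G W} = univ :=
        eq_univ_of_forall fun x => hup W _ _ .empty (hmeas X x)
          (factorLaw_mono W.1.2 (LE.le.eventuallyLE (empty_subset _))) h0
      have h1 := (hglb X W).1
      rw [huniv] at h1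
      have h2 := h1 (mem_univ (ρ X W - 1))
      linarith
    have hS : {x : ℝ | factorLaw P {ω | X.1 ω ≤ x} W.1.1 ∈ G W}.Nonempty := (hglb X W).nonempty
    have hiff : ∀ x, factorLaw P {ω | (X.comp φ hφ).1 ω ≤ φ x} W.1.1 ∈ G W ↔
        factorLaw P {ω | X.1 ω ≤ x} W.1.1 ∈ G W := fun x => by
      simp only [LInfty.comp, hmono.le_iff_le]
    refine (hglb (X.comp φ hφ) W).unique ⟨fun y hy => ?_, fun b hb => ?_⟩
    · -- A level outside the range of `φ` lies above it, since below it the event is empty.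
      by_contra! hlt
      by_cases hrange : ∃ x, φ x = y
      · obtain ⟨x, rfl⟩ := hrange
        exact absurd ((hglb X W).1 ((hiff x).1 hy)) (not_le.2 (hmono.lt_iff_lt.1 hlt))
      · have hbelow : ∀ x, y < φ x := by
          intro x
          by_contra! hx
          obtain ⟨z, hz⟩ := mem_range_of_exists_le_of_exists_ge hφ ⟨x, hx⟩ ⟨_, hlt.le⟩
          exact hrange ⟨z, hz⟩
        have hempty : {ω | (X.comp φ hφ).1 ω ≤ y} = ∅ :=
          eq_empty_of_forall_notMem fun ω hω => absurd hω (not_le.2 (hbelow (X.1 ω)))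
        have h1 : factorLaw P {ω | (X.comp φ hφ).1 ω ≤ y} W.1.1 ∈ G W := hy
        rw [hempty] at h1
        exact hzero h1
    · obtain ⟨u, -, -, hu, huS⟩ := (hglb X W).exists_seq_antitone_tendsto hS
      exact ge_of_tendsto ((hφ.tendsto _).comp hu)
        (Eventually.of_forall fun n => hb ((hiff (u n)).2 (huS n)))
  · have hW : P.map W.1.1 = P.map W'.1.1 :=
      (h.comp measurable_snd).map_eq
    have h1 := hglb X W
    simp only [factorLaw_eq_of_identDistrib W.1.2 W'.1.2 h, hlaw W W' hW] at h1
    exact h1.unique (hglb X' W')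

end Acceptance

/-! ### Representation by conditional distribution functions -/

section ConditionalForm

lemma measurable_ofReal_unitInterval {E : Type*} [MeasurableSpace E] {f : E → I}
    (hf : Measurable f) : Measurable fun w => ENNReal.ofReal (f w) :=
  ENNReal.measurable_ofReal.comp (measurable_subtype_coe.comp hf)

lemma ae_le_of_withDensity_le {E : Type*} [MeasurableSpace E] {μ : Measure E} [IsFiniteMeasure μ]
    {f g : E → I} (hf : Measurable f)
    (h : μ.withDensity (fun w => ENNReal.ofReal (f w)) ≤
      μ.withDensity (fun w => ENNReal.ofReal (g w))) : f ≤ᵐ[μ] g := by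
  have h1 : (fun w => ENNReal.ofReal (f w)) ≤ᵐ[μ] fun w => ENNReal.ofReal (g w) := by
    refine ae_le_of_forall_setLIntegral_le_of_sigmaFinite (measurable_ofReal_unitInterval hf)
      fun s hs _ => ?_
    rw [← withDensity_apply _ hs, ← withDensity_apply _ hs]
    exact h s
  filter_upwards [h1] with w hw
  exact (ENNReal.ofReal_le_ofReal_iff (g w).2.1).1 hw

variable {Ω : Type*} [MeasurableSpace Ω] {P : Measure Ω} [IsProbabilityMeasure P] {N : ℕ}
  {Y : Set (RandomVector Ω N)} {ρ : LInfty P → Y → ℝ}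

/-- The sub-laws of `W` with a density in `D`. -/
def lawsWithDensityIn (P : Measure Ω) {N : ℕ} (W : Ω → Fin N → ℝ)
    (D : Set ((Fin N → ℝ) → I)) : Set (Measure (Fin N → ℝ)) :=
  {ν | ∃ g ∈ D, ν = (P.map W).withDensity fun w => ENNReal.ofReal (g w)}

lemma memAE_condCDFGiven_iff {D : Set ((Fin N → ℝ) → I)} (hD : ∀ g ∈ D, Measurable g)
    {X : Ω → ℝ} {W : Ω → Fin N → ℝ} (hX : Measurable X) (hW : Measurable W) (x : ℝ) :
    MemAE (P.map W) (condCDFGiven P X W x) D ↔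
      factorLaw P {ω | X ω ≤ x} W ∈ lawsWithDensityIn P W D := by
  have : IsProbabilityMeasure (P.map W) := Measure.isProbabilityMeasure_map hW.aemeasurable
  rw [← withDensity_condCDFGiven hX hW x]
  refine exists_congr fun g => and_congr_right fun hg => ⟨fun h => withDensity_congr_ae ?_,
    fun h => ?_⟩
  · filter_upwards [h] with w hw
    rw [hw]
  · exact (ae_le_of_withDensity_le (measurable_condCDFGiven X W x) h.le).antisymm
      (ae_le_of_withDensity_le (hD g hg) h.ge)

theorem hasConditionalForm_of_axioms (hP : IsAtomless P) (hY : IsLawInvariantSet P Y)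
    (hM : Monotonicity ρ) (hO : Ordinality ρ) (hL : LawInvariance ρ) : HasConditionalForm ρ := by
  let D : Y → Set ((Fin N → ℝ) → I) := fun W =>
    {f | Measurable f ∧ (P.map W.1.1).withDensity (fun w => ENNReal.ofReal (f w)) ∈
      acceptedLaws ρ W}
  refine ⟨D, fun W => ⟨fun f hf => hf.1, ?_, ?_, ?_⟩, ?_, fun X W => ?_⟩
  · refine ⟨measurable_const, ?_⟩
    simpa using map_mem_acceptedLaws hP hY hM hO hL W
  · rintro ⟨-, h⟩
    refine zero_notMem_acceptedLaws hP hY hM hO hL W ?_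
    simpa using h
  · rintro f ⟨-, hf⟩ g hg hfg
    refine ⟨hg, acceptedLaws_upper hf (withDensity_mono (Eventually.of_forall fun w =>
      ENNReal.ofReal_le_ofReal (hfg w))) ?_⟩
    calc (P.map W.1.1).withDensity (fun w => ENNReal.ofReal (g w))
        ≤ (P.map W.1.1).withDensity 1 := withDensity_mono (Eventually.of_forall fun w => by
          simpa using (g w).2.2)
      _ = P.map W.1.1 := withDensity_one
  · intro W W' h
    simp only [D, acceptedLaws_eq h.map_eq, h.map_eq]
  · have h1 := isGLB_acceptedLaws hP hY hM hO hL X W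
    refine Eq.subst (motive := fun s => IsGLB s (ρ X W)) (Set.ext fun x => ?_) h1
    rw [mem_ofPred_eq, mem_ofPred_eq, memAE_condCDFGiven_iff (fun g hg => hg.1) X.2.1 W.1.2]
    symm
    constructor
    · rintro ⟨g, hg, h⟩
      rw [h]
      exact hg.2
    · intro h
      refine ⟨_, ⟨measurable_condCDFGiven X.1 W.1.1 x, ?_⟩,
        (withDensity_condCDFGiven X.2.1 W.1.2 x).symm⟩
      rwa [withDensity_condCDFGiven X.2.1 W.1.2 x]

/-- Every event `B` is `{X ≤ 0}` for the loss `X = 1_{Bᶜ}`; its conditional probability is the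
conditional distribution function of this loss at `0`. -/
lemma factorLaw_eq_withDensity {B : Set Ω} (hB : MeasurableSet B) {W : Ω → Fin N → ℝ}
    (hW : Measurable W) :
    factorLaw P B W = (P.map W).withDensity fun w =>
      ENNReal.ofReal (condCDFGiven P (lossOff (P := P) hB).1 W 0 w) := by
  rw [withDensity_condCDFGiven (lossOff hB).2.1 hW]
  congr 1
  ext ω
  by_cases h : ω ∈ B <;> simp [lossOff, h]

theorem axioms_of_hasConditionalForm (h : HasConditionalForm ρ) :
    Monotonicity ρ ∧ Ordinality ρ ∧ LawInvariance ρ := by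
  obtain ⟨D, hD, hlaw, hglb⟩ := h
  refine axioms_of_isGLB (G := fun W => lawsWithDensityIn P W.1.1 (D W)) ?_ ?_ ?_
  · intro W W' h
    simp only [lawsWithDensityIn, hlaw W W' (identDistrib_of_map_eq h), h]
  · rintro W A B - hB hAB ⟨g, hg, hgA⟩
    have : IsProbabilityMeasure (P.map W.1.1) :=
      Measure.isProbabilityMeasure_map W.1.2.aemeasurable
    set f := condCDFGiven P (lossOff (P := P) hB).1 W.1.1 0 with hf
    have hfm : Measurable f := measurable_condCDFGiven _ _ _
    have hgm : Measurable g := (hD W).measurable g hg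
    rw [hgA, factorLaw_eq_withDensity hB W.1.2] at hAB
    have hgf : g ≤ᵐ[P.map W.1.1] f := ae_le_of_withDensity_le hgm hAB
    refine ⟨fun w => max (g w) (f w), (hD W).upper g hg _ (hgm.max hfm)
      (fun w => le_max_left _ _), ?_⟩
    rw [factorLaw_eq_withDensity hB W.1.2]
    refine withDensity_congr_ae ?_
    filter_upwards [hgf] with w hw
    rw [max_eq_right hw]
  · intro X W
    simp only [← memAE_condCDFGiven_iff (hD W).measurable X.2.1 W.1.2]
    exact hglb X W

end ConditionalForm

/-! ### Representation by quantile boxes -/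

section QuantileBoxForm

variable {Ω : Type*} [MeasurableSpace Ω] {P : Measure Ω} {N : ℕ}

/-- The proportions of the law of `W` that the sub-law `ν` takes up in the quantile boxes. The
projection to the unit interval acts trivially for `ν ≤ P.map W`. -/
noncomputable def boxRatio (P : Measure Ω) {N : ℕ} (W : Ω → Fin N → ℝ) (ν : Measure (Fin N → ℝ))
    (p : boxIndex P W) : I :=
  projIcc 0 1 zero_le_one
    (ν.real (valueBox P W p.1.1 p.1.2) / (P.map W).real (valueBox P W p.1.1 p.1.2))

lemma boxRatio_coe [IsProbabilityMeasure P] {W : Ω → Fin N → ℝ} (hW : Measurable W)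
    {ν : Measure (Fin N → ℝ)} (hν : ν ≤ P.map W) (p : boxIndex P W) :
    (boxRatio P W ν p : ℝ) =
      ν.real (valueBox P W p.1.1 p.1.2) / (P.map W).real (valueBox P W p.1.1 p.1.2) := by
  have : IsProbabilityMeasure (P.map W) := Measure.isProbabilityMeasure_map hW.aemeasurable
  rw [boxRatio, projIcc_of_mem]
  refine ⟨by positivity, div_le_one_of_le₀ ?_ measureReal_nonneg⟩
  exact ENNReal.toReal_mono (measure_ne_top _ _) (hν _)

lemma boxRatio_le_boxRatio_iff [IsProbabilityMeasure P] {W : Ω → Fin N → ℝ} (hW : Measurable W)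
    {ν ν' : Measure (Fin N → ℝ)} (hν : ν ≤ P.map W) (hν' : ν' ≤ P.map W) :
    boxRatio P W ν ≤ boxRatio P W ν' ↔ ν ≤ ν' := by
  have : IsProbabilityMeasure (P.map W) := Measure.isProbabilityMeasure_map hW.aemeasurable
  have : IsFiniteMeasure ν := isFiniteMeasure_of_le _ hν
  have : IsFiniteMeasure ν' := isFiniteMeasure_of_le _ hν'
  constructor
  · intro h
    refine le_of_valueBox_le hW hν hν' fun p hp => ?_
    have h1 : (boxRatio P W ν ⟨p, hp⟩ : ℝ) ≤ boxRatio P W ν' ⟨p, hp⟩ := h ⟨p, hp⟩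
    rw [boxRatio_coe hW hν, boxRatio_coe hW hν'] at h1
    have hpos : 0 < (P.map W).real (valueBox P W p.1 p.2) := by
      rw [measureReal_def, map_valueBox hW]
      exact ENNReal.toReal_pos hp.2.2.ne' (measure_ne_top _ _)
    rw [div_le_div_iff_of_pos_right hpos] at h1
    exact (ENNReal.toReal_le_toReal (measure_ne_top _ _) (measure_ne_top _ _)).1 h1
  · intro h p
    refine Subtype.coe_le_coe.1 ?_
    rw [boxRatio_coe hW hν, boxRatio_coe hW hν']
    gcongr
    exact ENNReal.toReal_mono (measure_ne_top _ _) (h _)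

lemma boxCDF_eq_boxRatio [IsProbabilityMeasure P] {X : Ω → ℝ} {W : Ω → Fin N → ℝ}
    (hW : Measurable W) (x : ℝ) :
    boxCDF P X W x = boxRatio P W (factorLaw P {ω | X ω ≤ x} W) := by
  funext p
  refine Subtype.ext ?_
  have hQ : MeasurableSet (quantileBox P W p.1.1 p.1.2) := hW (measurableSet_valueBox W _ _)
  rw [boxRatio_coe hW (factorLaw_le_map hW)]
  simp only [boxCDF, measureReal_def, map_valueBox hW,
    factorLaw_apply hW (measurableSet_valueBox W _ _), cond_apply hQ, ENNReal.toReal_mul,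
    ENNReal.toReal_inv]
  rw [mul_comm, ← div_eq_mul_inv]
  rfl

/-- The transport of indices between factors with the same law, in a form free of casts. -/
lemma mem_boxIndex_of_identDistrib {W W' : Ω → Fin N → ℝ} (h : IdentDistrib W W' P P)
    {p : (Fin N → ℝ) × (Fin N → ℝ)} (hp : p ∈ boxIndex P W) : p ∈ boxIndex P W' :=
  (Set.ext_iff.1 (boxIndex_eq_of_identDistrib h) p).1 hp

lemma boxRatio_transport {W W' : Ω → Fin N → ℝ} (hW : Measurable W) (hW' : Measurable W')
    (h : IdentDistrib W W' P P) (ν : Measure (Fin N → ℝ)) :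
    (fun p : boxIndex P W => boxRatio P W' ν ⟨p.1, mem_boxIndex_of_identDistrib h p.2⟩) =
      boxRatio P W ν := by
  funext p
  simp only [boxRatio, valueBox_eq_of_map_eq hW hW' h.map_eq, h.map_eq]

variable {Y : Set (RandomVector Ω N)} {ρ : LInfty P → Y → ℝ}

/-- The functions on `S_W` that dominate the box proportions of an acceptable sub-law. -/
def acceptedBoxRatios (ρ : LInfty P → Y → ℝ) (W : Y) : Set (boxIndex P W.1.1 → I) :=
  {f | ∃ ν ∈ acceptedLaws ρ W, boxRatio P W.1.1 ν ≤ f}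

lemma acceptedBoxRatios_transport (W W' : Y) (h : IdentDistrib W.1.1 W'.1.1 P P)
    (f : boxIndex P W'.1.1 → I) :
    (fun p : boxIndex P W.1.1 => f ⟨p.1, mem_boxIndex_of_identDistrib h p.2⟩) ∈
      acceptedBoxRatios ρ W ↔ f ∈ acceptedBoxRatios ρ W' := by
  simp only [acceptedBoxRatios, mem_ofPred_eq, acceptedLaws_eq h.map_eq]
  refine exists_congr fun ν => and_congr_right fun _ => ?_
  rw [← boxRatio_transport W.1.2 W'.1.2 h ν]
  exact ⟨fun h1 p => h1 ⟨p.1, mem_boxIndex_of_identDistrib h.symm p.2⟩, fun h1 p => h1 _⟩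

variable [IsProbabilityMeasure P]

lemma isIncreasing_acceptedBoxRatios (hP : IsAtomless P) (hY : IsLawInvariantSet P Y)
    (hM : Monotonicity ρ) (hO : Ordinality ρ) (hL : LawInvariance ρ) (W : Y) :
    IsIncreasing (acceptedBoxRatios ρ W) := by
  refine ⟨?_, ?_, ?_⟩
  · exact ⟨_, map_mem_acceptedLaws hP hY hM hO hL W, fun p => unitInterval.le_one'⟩
  · rintro ⟨ν, hν, h⟩
    have h0 : ν ≤ 0 := (boxRatio_le_boxRatio_iff W.1.2 hν.1 (Measure.zero_le _)).1
      (h.trans fun p => unitInterval.nonneg')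
    rw [le_antisymm h0 (Measure.zero_le _)] at hν
    exact zero_notMem_acceptedLaws hP hY hM hO hL W hν
  · rintro f ⟨ν, hν, h⟩ g hfg
    exact ⟨ν, hν, h.trans hfg⟩

lemma boxCDF_mem_acceptedBoxRatios_iff (X : LInfty P) (W : Y) (x : ℝ) :
    boxCDF P X.1 W.1.1 x ∈ acceptedBoxRatios ρ W ↔
      factorLaw P {ω | X.1 ω ≤ x} W.1.1 ∈ acceptedLaws ρ W := by
  rw [boxCDF_eq_boxRatio W.1.2]
  constructor
  · rintro ⟨ν, hν, h⟩
    exact acceptedLaws_upper hν ((boxRatio_le_boxRatio_iff W.1.2 hν.1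
      (factorLaw_le_map W.1.2)).1 h) (factorLaw_le_map W.1.2)
  · exact fun h => ⟨_, h, le_rfl⟩

theorem hasQuantileBoxForm_of_axioms (hP : IsAtomless P) (hY : IsLawInvariantSet P Y)
    (hM : Monotonicity ρ) (hO : Ordinality ρ) (hL : LawInvariance ρ) : HasQuantileBoxForm ρ := by
  refine ⟨acceptedBoxRatios ρ, isIncreasing_acceptedBoxRatios hP hY hM hO hL,
    acceptedBoxRatios_transport, fun X W => ?_⟩
  simp only [boxCDF_mem_acceptedBoxRatios_iff]
  exact isGLB_acceptedLaws hP hY hM hO hL X W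

/-- The measures whose box proportions belong to `D`. -/
def lawsWithBoxRatioIn (P : Measure Ω) {N : ℕ} (W : Ω → Fin N → ℝ)
    (D : Set (boxIndex P W → I)) : Set (Measure (Fin N → ℝ)) :=
  {ν | boxRatio P W ν ∈ D}

lemma mem_lawsWithBoxRatioIn_of_le {W : Ω → Fin N → ℝ} (hW : Measurable W)
    {D : Set (boxIndex P W → I)} (hD : IsIncreasing D) {ν ν' : Measure (Fin N → ℝ)}
    (h : ν ≤ ν') (hν' : ν' ≤ P.map W) (hν : ν ∈ lawsWithBoxRatioIn P W D) :
    ν' ∈ lawsWithBoxRatioIn P W D :=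
  hD.upper _ hν _ ((boxRatio_le_boxRatio_iff hW (h.trans hν') hν').2 h)

lemma boxCDF_mem_iff {W : Ω → Fin N → ℝ} (hW : Measurable W) {D : Set (boxIndex P W → I)}
    (X : Ω → ℝ) (x : ℝ) :
    boxCDF P X W x ∈ D ↔ factorLaw P {ω | X ω ≤ x} W ∈ lawsWithBoxRatioIn P W D := by
  rw [boxCDF_eq_boxRatio hW]
  rfl

theorem axioms_of_hasQuantileBoxForm (h : HasQuantileBoxForm ρ) :
    Monotonicity ρ ∧ Ordinality ρ ∧ LawInvariance ρ := by
  obtain ⟨D, hD, hlaw, hglb⟩ := h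
  refine axioms_of_isGLB (G := fun W => lawsWithBoxRatioIn P W.1.1 (D W)) ?_ ?_ ?_
  · intro W W' h
    ext ν
    have h1 := hlaw W W' (identDistrib_of_map_eq h) (boxRatio P W'.1.1 ν)
    rwa [boxRatio_transport W.1.2 W'.1.2 (identDistrib_of_map_eq h) ν] at h1
  · intro W A B _ _ hAB hA
    exact mem_lawsWithBoxRatioIn_of_le W.1.2 (hD W) hAB (factorLaw_le_map W.1.2) hA
  · intro X W
    simp only [← boxCDF_mem_iff W.1.2]
    exact hglb X W

end QuantileBoxForm

end FactorRisk

theorem mainTheorem2 {Ω : Type*} [MeasurableSpace Ω] (P : Measure Ω) [IsProbabilityMeasure P]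
    (hP : FactorRisk.IsAtomless P) (N : ℕ) (hN : 1 ≤ N)
    (Y : Set (FactorRisk.RandomVector Ω N)) (hY : FactorRisk.IsLawInvariantSet P Y)
    (ρ : FactorRisk.LInfty P → Y → ℝ) :
    ((FactorRisk.Monotonicity ρ ∧ FactorRisk.Ordinality ρ ∧ FactorRisk.LawInvariance ρ) ↔
        FactorRisk.HasConditionalForm ρ) ∧
      ((FactorRisk.Monotonicity ρ ∧ FactorRisk.Ordinality ρ ∧ FactorRisk.LawInvariance ρ) ↔
        FactorRisk.HasQuantileBoxForm ρ) :=
  ⟨⟨fun h => FactorRisk.hasConditionalForm_of_axioms hP hY h.1 h.2.1 h.2.2,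
      FactorRisk.axioms_of_hasConditionalForm⟩,
    ⟨fun h => FactorRisk.hasQuantileBoxForm_of_axioms hP hY h.1 h.2.1 h.2.2,
      FactorRisk.axioms_of_hasQuantileBoxForm⟩⟩
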